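/- Let $\mathcal A$ be a premodular category (that is, a ribbon fusion category) over an algebraically closed field $\Bbbk$, with braiding $c$. Let $X_i$, $i\in\mathrm{Irr}(\mathcal A)$, be representatives of the isomorphism classes of simple objects, let $d_i$ be the categorical dimension of $X_i$ (which is nonzero), and let $\mathfrak D=\sum_i d_i^2$. Let $V=K(\mathcal A)\otimes_{\mathbb Z}\Bbbk$ be the Verlinde algebra, with basis $x_i=[X_i]$. It carries the fusion product $$x_i\cdot x_j=\sum_k N_{ij}^k\,x_k,$$ where $N_{ij}^k$ is the multiplicity of $X_k$ in $X_i\otimes X_j$, and the convolution product $$x_i * x_j=\frac{\delta_{ij}}{d_i}\,x_i .$$ Put $s_{ij}=\operatorname{tr}(c_{X_j,X_i^*}\circ c_{X_i^*,X_j})$ and $\overline s_{ij}=\operatorname{tr}(c_{X_i^*,X_j}^{-1}\circ c_{X_j,X_i^*}^{-1})$, where $\operatorname{tr}$ is the categorical trace, and let $s,\overline s:V\to V$ be the linear operators with $s(x_i)=\sum_j s_{ij}x_j$ and $\overline s(x_i)=\sum_j\overline s_{ij}x_j$. Let $J\subset\mathrm{Irr}(\mathcal A)$ be the set of those $i$ for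 which $X_i$ is transparent, i.e. $c_{Y,X_i}\circ c_{X_i,Y}=\mathrm{id}$ for every object $Y$ of $\mathcal A$, and let $\varphi_J=\sum_{i\in J}d_i\,x_i\in V$. Then for all $x,y\in V$ $$s\big((\mathfrak D\varphi_J\cdot x)*y\big)=s\big(x*(\mathfrak D\varphi_J\cdot y)\big)=s(x)\cdot s(y),$$ $$\overline s\big((\mathfrak D\varphi_J\cdot x)*y\big)=\overline s\big(x*(\mathfrak D\varphi_J\cdot y)\big)=\overline s(x)\cdot\overline s(y).$$ -/

import Mathlib

open CategoryTheory MonoidalCategory BraidedCategory Limits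

universe w v u

noncomputable section

namespace Premodular

/-- A ribbon category: a rigid braided category with a twist `θ`, that is, a natural automorphism of
the identity functor with `θ_{X ⊗ Y} = c_{Y,X} ∘ c_{X,Y} ∘ (θ_X ⊗ θ_Y)` and `θ_{X*} = (θ_X)*`.
The dual `X*` is Mathlib's `Xᘁ`, with evaluation `X* ⊗ X ⟶ 𝟙` and coevaluation `𝟙 ⟶ X ⊗ X*`;
in a braided category the existence of these duals gives those on the other side. -/
class RibbonCategory (C : Type u) [Category.{v} C] [MonoidalCategory C] [BraidedCategory C]
    [RightRigidCategory C] where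
  /-- the twist -/
  twist : ∀ X : C, X ≅ X
  twist_naturality : ∀ {X Y : C} (f : X ⟶ Y), f ≫ (twist Y).hom = (twist X).hom ≫ f
  twist_tensor : ∀ X Y : C,
    (twist (X ⊗ Y)).hom =
      ((twist X).hom ⊗ₘ (twist Y).hom) ≫ (β_ X Y).hom ≫ (β_ Y X).hom
  twist_dual : ∀ X : C, (twist (Xᘁ)).hom = ((twist X).hom)ᘁ

/-- The conditions which make a `k`-linear abelian rigid monoidal category (with bilinear tensor
product) a fusion category: the unit is simple, morphism spaces are finite-dimensional, every
object is a finite direct sum of simple objects, and there are finitely many simple objects up to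
isomorphism. -/
class IsFusion (k : Type w) [Field k] (C : Type u) [Category.{v} C] [Abelian C] [Linear k C]
    [MonoidalCategory C] : Prop where
  simple_unit : Simple (𝟙_ C)
  finiteDimensional_hom : ∀ X Y : C, FiniteDimensional k (X ⟶ Y)
  semisimple : ∀ X : C, ∃ (n : ℕ) (S : Fin n → C) (b : Bicone S),
    (∀ a, Simple (S a)) ∧ Nonempty b.IsBilimit ∧ Nonempty (X ≅ b.pt)
  finite_simple : ∃ (n : ℕ) (S : Fin n → C), ∀ Y : C, Simple Y → ∃ a, Nonempty (Y ≅ S a)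

attribute [instance] IsFusion.simple_unit IsFusion.finiteDimensional_hom

/-- A family `X_i`, `i ∈ ι`, with exactly one representative of each isomorphism class of simple
objects; `ι` is thereby identified with the set of isomorphism classes of simple objects. -/
structure SimpleReps (C : Type u) [Category.{v} C] [HasZeroMorphisms C] (ι : Type*) where
  /-- the representatives -/
  obj : ι → C
  simple : ∀ i, Simple (obj i)
  eq_of_iso : ∀ i j, Nonempty (obj i ≅ obj j) → i = j
  exists_iso : ∀ Y : C, Simple Y → ∃ i, Nonempty (Y ≅ obj i)

/-- `X` is transparent: its double braiding with every object is trivial. -/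
def IsTransparent {C : Type u} [Category.{v} C] [MonoidalCategory C] [BraidedCategory C]
    (X : C) : Prop :=
  ∀ Y : C, (β_ X Y).hom ≫ (β_ Y X).hom = 𝟙 (X ⊗ Y)

section Trace

variable (k : Type w) [Field k] [IsAlgClosed k] {C : Type u} [Category.{v} C] [Abelian C]
  [Linear k C] [MonoidalCategory C] [IsFusion k C]

/-- The identification of the endomorphisms of the unit with `k`: the scalar `c` with
`f = c • 𝟙`. -/
def unitScalar (f : 𝟙_ C ⟶ 𝟙_ C) : k :=
  Classical.choose (endomorphism_simple_eq_smul_id k f)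

theorem unitScalar_smul (f : 𝟙_ C ⟶ 𝟙_ C) : unitScalar k f • 𝟙 (𝟙_ C) = f :=
  Classical.choose_spec (endomorphism_simple_eq_smul_id k f)

variable [BraidedCategory C] [RightRigidCategory C] [RibbonCategory C]

/-- The quantum trace of an endomorphism in a ribbon category,
`𝟙 ⟶ X ⊗ X* ⟶ X ⊗ X* ⟶ X* ⊗ X ⟶ 𝟙`: coevaluation, `θ_X ∘ f` on the first factor, braiding,
evaluation. -/
def trace {X : C} (f : X ⟶ X) : k :=
  unitScalar k (η_ X (Xᘁ) ≫ (f ≫ (RibbonCategory.twist X).hom) ▷ (Xᘁ) ≫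
    (β_ X (Xᘁ)).hom ≫ ε_ X (Xᘁ))

/-- The categorical dimension. -/
def dim (X : C) : k := trace k (𝟙 X)

end Trace

section Verlinde

variable (k : Type w) [Field k] [IsAlgClosed k] {C : Type u} [Category.{v} C] [Abelian C]
  [Linear k C] [MonoidalCategory C] [IsFusion k C]
  [BraidedCategory C] [RightRigidCategory C] [RibbonCategory C]
  {ι : Type*} [Fintype ι] (X : SimpleReps C ι)

/-- The global dimension `𝔇 = ∑ d_i²`. -/
def globalDim : k := ∑ i, dim k (X.obj i) ^ 2

/-- `s_{ij}`, the trace of `c_{j,i*} ∘ c_{i*,j}` on `X_i* ⊗ X_j`. -/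
def sMatrix (i j : ι) : k :=
  trace k ((β_ ((X.obj i)ᘁ) (X.obj j)).hom ≫ (β_ (X.obj j) ((X.obj i)ᘁ)).hom)

/-- `s̄_{ij}`, the trace of `c_{i*,j}⁻¹ ∘ c_{j,i*}⁻¹` on `X_i* ⊗ X_j`. -/
def sBarMatrix (i j : ι) : k :=
  trace k ((β_ (X.obj j) ((X.obj i)ᘁ)).inv ≫ (β_ ((X.obj i)ᘁ) (X.obj j)).inv)

/-- `N_{ij}^l`, the multiplicity of the simple object `X_l` in `X_i ⊗ X_j`. -/
def fusionCoeff (i j l : ι) : ℕ := Module.finrank k (X.obj l ⟶ X.obj i ⊗ X.obj j)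

/-- The underlying vector space of the Verlinde algebra (the Grothendieck ring with coefficients
extended to `k`): the free `k`-module on the classes `x_i` of the simple objects. -/
abbrev Verlinde (k : Type*) [Field k] (ι : Type*) : Type _ := ι →₀ k

/-- The basis vector `x_i` of the Verlinde algebra. -/
def basisVec (i : ι) : Verlinde k ι := Finsupp.single i 1

/-- The fusion product, bilinear with `x_i · x_j = ∑_l N_{ij}^l x_l`. -/
def fusion : Verlinde k ι →ₗ[k] Verlinde k ι →ₗ[k] Verlinde k ι :=
  Finsupp.linearCombination k fun i => Finsupp.linearCombination k fun j =>
    ∑ l, (fusionCoeff k X i j l : k) • basisVec k l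

open Classical in
/-- The convolution product, bilinear with `x_i * x_j = (δ_{ij} / d_i) x_i`. (Simple objects
have nonzero dimension.) -/
def conv : Verlinde k ι →ₗ[k] Verlinde k ι →ₗ[k] Verlinde k ι :=
  Finsupp.linearCombination k fun i => Finsupp.linearCombination k fun j =>
    ((if i = j then 1 else 0) / dim k (X.obj i)) • basisVec k i

/-- The linear operator with `s(x_i) = ∑_j s_{ij} x_j`. -/
def sMap : Verlinde k ι →ₗ[k] Verlinde k ι :=
  Finsupp.linearCombination k fun i => ∑ j, sMatrix k X i j • basisVec k j

/-- The linear operator with `s̄(x_i) = ∑_j s̄_{ij} x_j`. -/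
def sBarMap : Verlinde k ι →ₗ[k] Verlinde k ι :=
  Finsupp.linearCombination k fun i => ∑ j, sBarMatrix k X i j • basisVec k j

open Classical in
/-- `φ_J = ∑_{i ∈ J} d_i x_i`, where `J` is the set of transparent simple objects. -/
def phiJ : Verlinde k ι :=
  ∑ i with IsTransparent (X.obj i), dim k (X.obj i) • basisVec k i

end Verlinde

end Premodular

end

/-! Let S(Y, L) be the trace of the double braiding (`linking`), so that s_{ij} = S(i*, j). By
bilinearity the claim reduces to basis vectors x_a, x_b: both sides must be the same multiple of
s(x_a).

For Y simple, L ↦ S(Y, L)/d_Y is a character of the fusion ring (`linking_mul_linking`), because a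
loop L around Y closes up to a scalar. Rotating N_{jl}^m to N_{m l*}^j, the character of a* turns
the coefficient of x_m in s(x_a)·s(x_b) into (s_{am}/d_a) ∑_l S(a, l) S(b*, l); here S(a*, l*) =
S(a, l) is used. The characters of the X_l turn the remaining sum into ∑_c N_{ab*}^c ∑_l d_l S(c,
l).

The killing property `sum_dim_mul_linking` evaluates the inner sum: it is 𝔇 d_c for transparent c
and 0 otherwise. It rests on the handle slide `sum_dim_mul_trace_whiskerRight`: a strand M may be
slid over the weighted sum of loops around Y. So if ∑_l d_l S(Y, l) ≠ 0, the double braiding of Y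
with M cannot be told from the identity by traces, and nondegeneracy of the trace form makes Y
transparent. Nothing is divided by 𝔇, which may vanish.

The identities for s̄ are those for s in the category with reversed braiding and inverse twist,
where traces are unchanged. -/

set_option linter.unusedSectionVars false

noncomputable section

namespace Premodular

/-! ### Double braidings and nested evaluations -/

section Braided

variable {C : Type u} [Category.{v} C] [MonoidalCategory C] [BraidedCategory C]

/-- The double braiding of `Y` with `L`. -/
def doubleBraiding (Y L : C) : Y ⊗ L ⟶ Y ⊗ L := (β_ Y L).hom ≫ (β_ L Y).hom

theorem braiding_right_comp_whiskerRight (L : C) {A : C} (e : A ⟶ 𝟙_ C) :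
    (β_ L A).hom ≫ e ▷ L = L ◁ e ⊗≫ 𝟙 _ := by
  rw [← braiding_naturality_right, braiding_tensorUnit_right]
  monoidal

/-- By the hexagon, L crosses Y ⊗ D as a whole, and this crossing disappears once `e` maps Y ⊗ D to
the unit. Crossing D alone is thus undoing the crossing of Y. -/
theorem whiskerLeft_braiding_comp_whiskerRight (L Y D : C) (e : Y ⊗ D ⟶ 𝟙_ C) :
    Y ◁ (β_ L D).hom ⊗≫ e ▷ L =
      𝟙 _ ⊗≫ (β_ L Y).inv ▷ D ⊗≫ L ◁ e ⊗≫ 𝟙 _ := by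
  have h := braiding_right_comp_whiskerRight L e
  calc
    _ = 𝟙 _ ⊗≫ ((β_ L Y).inv ≫ (β_ L Y).hom) ▷ D ⊗≫ Y ◁ (β_ L D).hom ⊗≫ e ▷ L := by
      rw [Iso.inv_hom_id]; monoidal
    _ = 𝟙 _ ⊗≫ (β_ L Y).inv ▷ D ⊗≫ ((β_ L (Y ⊗ D)).hom ≫ e ▷ L) := by
      rw [braiding_tensor_right_hom]; monoidal
    _ = _ := by rw [h]

/-- The double braiding supplied by the twist of Y ⊗ L cancels the entanglement of the two strands,
leaving nested caps. This is what makes the trace compatible with tensor products. -/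
theorem doubleBraiding_comp_braiding_comp_evaluation (Y L Y' L' : C) [ExactPairing Y Y']
    [ExactPairing L L'] :
    doubleBraiding Y L ▷ (L' ⊗ Y') ≫ (β_ (Y ⊗ L) (L' ⊗ Y')).hom ≫ ε_ (Y ⊗ L) (L' ⊗ Y') =
      𝟙 _ ⊗≫ Y ◁ ((β_ L L').hom ≫ ε_ L L') ▷ Y' ⊗≫ ((β_ Y Y').hom ≫ ε_ Y Y') := by
  have hY := whiskerLeft_braiding_comp_whiskerRight L Y Y' ((β_ Y Y').hom ≫ ε_ Y Y')
  have hL := whiskerLeft_braiding_comp_whiskerRight Y L L' ((β_ L L').hom ≫ ε_ L L')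
  have hn := braiding_naturality_left (β_ L Y).inv L'
  calc
    _ = doubleBraiding Y L ▷ (L' ⊗ Y') ⊗≫ (β_ (Y ⊗ L) L').hom ▷ Y' ⊗≫
          L' ◁ (Y ◁ (β_ L Y').hom ⊗≫ ((β_ Y Y').hom ≫ ε_ Y Y') ▷ L) ⊗≫ ε_ L L' := by
      rw [ExactPairing.tensor_evaluation, braiding_tensor_right_hom, braiding_tensor_left_hom Y L Y']
      monoidal
    _ = doubleBraiding Y L ▷ (L' ⊗ Y') ⊗≫ ((β_ (Y ⊗ L) L').hom ≫ L' ◁ (β_ L Y).inv) ▷ Y' ⊗≫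
          L' ◁ L ◁ ((β_ Y Y').hom ≫ ε_ Y Y') ⊗≫ ε_ L L' := by
      rw [hY]; monoidal
    _ = ((β_ Y L).hom ≫ (β_ L Y).hom ≫ (β_ L Y).inv) ▷ (L' ⊗ Y') ⊗≫ L ◁ (β_ Y L').hom ▷ Y' ⊗≫
          ((β_ L L').hom ▷ (Y ⊗ Y') ≫ (L' ⊗ L) ◁ ((β_ Y Y').hom ≫ ε_ Y Y')) ⊗≫ ε_ L L' := by
      rw [← hn, doubleBraiding, braiding_tensor_left_hom]; monoidal
    _ = (β_ Y L).hom ▷ (L' ⊗ Y') ⊗≫ L ◁ (β_ Y L').hom ▷ Y' ⊗≫ (β_ L L').hom ▷ (Y ⊗ Y') ⊗≫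
          ((L' ⊗ L) ◁ ((β_ Y Y').hom ≫ ε_ Y Y') ≫ ε_ L L' ▷ 𝟙_ C) ⊗≫ 𝟙 _ := by
      rw [Iso.hom_inv_id, Category.comp_id]; monoidal
    _ = (β_ Y L).hom ▷ (L' ⊗ Y') ⊗≫ (L ◁ (β_ Y L').hom ⊗≫ ((β_ L L').hom ≫ ε_ L L') ▷ Y) ▷ Y' ⊗≫
          ((β_ Y Y').hom ≫ ε_ Y Y') := by
      rw [whisker_exchange]; monoidal
    _ = ((β_ Y L).hom ≫ (β_ Y L).inv) ▷ (L' ⊗ Y') ⊗≫ Y ◁ ((β_ L L').hom ≫ ε_ L L') ▷ Y' ⊗≫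
          ((β_ Y Y').hom ≫ ε_ Y Y') := by
      rw [hL]; monoidal
    _ = _ := by rw [Iso.hom_inv_id]; monoidal

theorem doubleBraiding_naturality {Y Y' L L' : C} (f : Y ⟶ Y') (g : L ⟶ L') :
    (f ⊗ₘ g) ≫ doubleBraiding Y' L' = doubleBraiding Y L ≫ (f ⊗ₘ g) := by
  simp [doubleBraiding]

theorem doubleBraiding_naturality_right (Y : C) {L L' : C} (g : L ⟶ L') :
    Y ◁ g ≫ doubleBraiding Y L' = doubleBraiding Y L ≫ Y ◁ g := by
  simp [doubleBraiding]

/-- The double braiding with a tensor product, up to associators. -/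
theorem doubleBraiding_tensor (Y M L : C) :
    (α_ Y M L).hom ≫ doubleBraiding Y (M ⊗ L) ≫ (α_ Y M L).inv =
      (β_ Y M).hom ▷ L ≫ (α_ M Y L).hom ≫ M ◁ doubleBraiding Y L ≫ (α_ M Y L).inv ≫
        (β_ M Y).hom ▷ L := by
  simp [doubleBraiding, braiding_tensor_right_hom, braiding_tensor_left_hom]

end Braided

/-! ### Traces, partial traces and bending in a ribbon category -/

section Ribbon

variable {C : Type u} [Category.{v} C] [MonoidalCategory C] [BraidedCategory C]
  [RightRigidCategory C] [RibbonCategory C]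

/-- The evaluation `X ⊗ D ⟶ 𝟙` on the other side, obtained from the twist and the braiding. -/
def cap (X D : C) [ExactPairing X D] : X ⊗ D ⟶ 𝟙_ C :=
  (RibbonCategory.twist X).hom ▷ D ≫ (β_ X D).hom ≫ ε_ X D

/-- The trace of `f`, as an endomorphism of the unit, computed with a given dual of `X`. -/
def unitTrace (X D : C) [ExactPairing X D] (f : X ⟶ X) : 𝟙_ C ⟶ 𝟙_ C :=
  η_ X D ≫ f ▷ D ≫ cap X D

/-- The partial trace over the second tensor factor. -/
def partialTrace (L D : C) [ExactPairing L D] {Y Y' : C} (g : Y ⊗ L ⟶ Y' ⊗ L) : Y ⟶ Y' :=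
  𝟙 _ ⊗≫ Y ◁ η_ L D ⊗≫ g ▷ D ⊗≫ Y' ◁ cap L D ⊗≫ 𝟙 _

theorem partialTrace_whiskerRight (L D : C) [ExactPairing L D] {Y Y' Z Z' : C} (a : Y ⟶ Y')
    (g : Y' ⊗ L ⟶ Z ⊗ L) (b : Z ⟶ Z') :
    partialTrace L D (a ▷ L ≫ g ≫ b ▷ L) = a ≫ partialTrace L D g ≫ b := by
  calc
    _ = 𝟙 _ ⊗≫ (Y ◁ η_ L D ≫ a ▷ (L ⊗ D)) ⊗≫ g ▷ D ⊗≫ (b ▷ (L ⊗ D) ≫ Z' ◁ cap L D) ⊗≫ 𝟙 _ := by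
      rw [partialTrace]; monoidal
    _ = 𝟙 _ ⊗≫ (a ▷ 𝟙_ C ≫ Y' ◁ η_ L D) ⊗≫ g ▷ D ⊗≫ (Z ◁ cap L D ≫ b ▷ 𝟙_ C) ⊗≫ 𝟙 _ := by
      rw [whisker_exchange a, whisker_exchange b]
    _ = _ := by rw [partialTrace]; monoidal

theorem partialTrace_whiskerLeft (L D : C) [ExactPairing L D] (M : C) {Y Y' : C}
    (g : Y ⊗ L ⟶ Y' ⊗ L) :
    partialTrace L D ((α_ M Y L).hom ≫ M ◁ g ≫ (α_ M Y' L).inv) = M ◁ partialTrace L D g := by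
  rw [partialTrace, partialTrace]; monoidal

theorem cap_naturality (X X' D D' : C) [ExactPairing X D] [ExactPairing X' D'] (f : X ⟶ X')
    (t : D' ⟶ D) (ht : t ▷ X ≫ ε_ X D = D' ◁ f ≫ ε_ X' D') :
    X ◁ t ≫ cap X D = f ▷ D' ≫ cap X' D' := by
  rw [cap, cap, whisker_exchange_assoc, braiding_naturality_right_assoc, ht,
    ← comp_whiskerRight_assoc, RibbonCategory.twist_naturality, comp_whiskerRight_assoc]
  simp only [braiding_naturality_left_assoc]

/-- The trace is cyclic and does not depend on the choice of the duals. -/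
theorem unitTrace_comp_comm (X X' D D' : C) [p : ExactPairing X D] [p' : ExactPairing X' D']
    (f : X ⟶ X') (g : X' ⟶ X) :
    unitTrace X D (f ≫ g) = unitTrace X' D' (g ≫ f) := by
  let i : HasRightDual X := ⟨D⟩
  let i' : HasRightDual X' := ⟨D'⟩
  have h1 : η_ X' D' ≫ X' ◁ fᘁ = η_ X D ≫ f ▷ D := coevaluation_comp_rightAdjointMate f
  have h2 : fᘁ ▷ X ≫ ε_ X D = D' ◁ f ≫ ε_ X' D' := rightAdjointMate_comp_evaluation f
  have h3 := cap_naturality X X' D D' f (fᘁ) h2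
  simp only [unitTrace, comp_whiskerRight, Category.assoc]
  rw [← reassoc_of% h1]
  have h4 : X' ◁ (fᘁ : D' ⟶ D) ≫ g ▷ D = g ▷ D' ≫ X ◁ (fᘁ : D' ⟶ D) := whisker_exchange _ _
  rw [reassoc_of% h4, h3]

theorem cap_tensor (Y L Y' L' : C) [ExactPairing Y Y'] [ExactPairing L L'] :
    cap (Y ⊗ L) (L' ⊗ Y') = 𝟙 _ ⊗≫ Y ◁ cap L L' ▷ Y' ⊗≫ cap Y Y' := by
  have h := doubleBraiding_comp_braiding_comp_evaluation Y L Y' L'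
  rw [cap, RibbonCategory.twist_tensor]
  calc
    _ = ((RibbonCategory.twist Y).hom ⊗ₘ (RibbonCategory.twist L).hom) ▷ (L' ⊗ Y') ≫
          doubleBraiding Y L ▷ (L' ⊗ Y') ≫ (β_ (Y ⊗ L) (L' ⊗ Y')).hom ≫
            ε_ (Y ⊗ L) (L' ⊗ Y') := by
      simp only [doubleBraiding, comp_whiskerRight, Category.assoc]
    _ = 𝟙 _ ⊗≫ Y ◁ (RibbonCategory.twist L).hom ▷ (L' ⊗ Y') ⊗≫
          ((RibbonCategory.twist Y).hom ▷ (L ⊗ L') ≫ Y ◁ ((β_ L L').hom ≫ ε_ L L')) ▷ Y' ⊗≫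
            ((β_ Y Y').hom ≫ ε_ Y Y') := by
      rw [h, tensorHom_def']; monoidal
    _ = _ := by
      rw [← whisker_exchange, cap, cap]; monoidal

theorem unitTrace_tensor (Y L Y' L' : C) [ExactPairing Y Y'] [ExactPairing L L']
    (f : Y ⊗ L ⟶ Y ⊗ L) :
    unitTrace (Y ⊗ L) (L' ⊗ Y') f = unitTrace Y Y' (partialTrace L L' f) := by
  rw [unitTrace, cap_tensor, ExactPairing.tensor_coevaluation, unitTrace, partialTrace]
  monoidal

/-- The trace on the dual of `X` can be computed from the duality between `X` and its dual. -/
theorem unitTrace_rightDual_id (X : C) :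
    unitTrace (Xᘁ) ((Xᘁ)ᘁ) (𝟙 _) = unitTrace X (Xᘁ) (𝟙 X) := by
  let p : ExactPairing (Xᘁ) X := exactPairing_swap X (Xᘁ)
  have h := unitTrace_comp_comm (Xᘁ) (Xᘁ) ((Xᘁ)ᘁ) X (𝟙 _) (𝟙 _)
  rw [Category.comp_id] at h
  have e1 : η_ (Xᘁ) X = η_ X (Xᘁ) ≫ (β_ (Xᘁ) X).inv := rfl
  have e2 : ε_ (Xᘁ) X = (β_ X (Xᘁ)).hom ≫ ε_ X (Xᘁ) := rfl
  rw [h, unitTrace, unitTrace, cap, cap, e1, e2]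
  have h3 : (RibbonCategory.twist X).homᘁ ▷ X ≫ ε_ X (Xᘁ) =
      (Xᘁ) ◁ (RibbonCategory.twist X).hom ≫ ε_ X (Xᘁ) := rightAdjointMate_comp_evaluation _
  rw [RibbonCategory.twist_dual, id_whiskerRight, id_whiskerRight, Category.id_comp,
    Category.id_comp]
  simp only [Category.assoc, braiding_naturality_left_assoc]
  rw [Iso.inv_hom_id_assoc, braiding_naturality_right_assoc, h3]

/-- Bending a morphism out of `D ⊗ J`, with `D` dual to `M`, to a morphism into `M ⊗ L`. -/
def bendUp (M D : C) [ExactPairing M D] {J L : C} (p : D ⊗ J ⟶ L) : J ⟶ M ⊗ L :=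
  tensorLeftHomEquiv J M D L p

/-- Bending a morphism into `D ⊗ J`, with `D` dual to `M`, to a morphism out of `M ⊗ L`. -/
def bendDown (M D : C) [ExactPairing M D] {J L : C} (q : L ⟶ D ⊗ J) : M ⊗ L ⟶ J :=
  M ◁ q ≫ (α_ _ _ _).inv ≫ cap M D ▷ J ≫ (λ_ _).hom

theorem bendUp_comp_bendDown (M D J L : C) [ExactPairing M D] (p : D ⊗ J ⟶ L) (q : L ⟶ D ⊗ J)
    {A B : C} (g : B ⊗ M ⟶ A ⊗ M) :
    B ◁ bendUp M D p ≫ (α_ B M L).inv ≫ g ▷ L ≫ (α_ A M L).hom ≫ A ◁ bendDown M D q =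
      𝟙 _ ⊗≫ B ◁ η_ M D ▷ J ⊗≫ g ▷ (D ⊗ J) ⊗≫ (A ⊗ M) ◁ (p ≫ q) ⊗≫ A ◁ cap M D ▷ J ⊗≫ 𝟙 _ := by
  calc
    _ = 𝟙 _ ⊗≫ B ◁ η_ M D ▷ J ⊗≫ ((B ⊗ M) ◁ p ≫ g ▷ L) ⊗≫ (A ⊗ M) ◁ q ⊗≫
          A ◁ cap M D ▷ J ⊗≫ 𝟙 _ := by
      simp only [bendUp, bendDown, tensorLeftHomEquiv, Equiv.coe_fn_mk]; monoidal
    _ = _ := by rw [whisker_exchange]; monoidal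

theorem partialTrace_whiskerRight_eq (M D J : C) [ExactPairing M D] {A B : C}
    (g : B ⊗ M ⟶ A ⊗ M) :
    partialTrace M D g ▷ J =
      𝟙 _ ⊗≫ B ◁ η_ M D ▷ J ⊗≫ g ▷ (D ⊗ J) ⊗≫ (A ⊗ M) ◁ 𝟙 (D ⊗ J) ⊗≫
        A ◁ cap M D ▷ J ⊗≫ 𝟙 _ := by
  rw [partialTrace]; monoidal

/-- The closed J-strand can be moved inside the closed M-strand, so a trace over J becomes a trace
over the dual of M of a partial trace. -/
theorem unitTrace_bendUp_comp_bendDown (M D J J' L : C) [ExactPairing M D] [ExactPairing J J']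
    (p : D ⊗ J ⟶ L) (q : L ⟶ D ⊗ J) :
    unitTrace J J' (bendUp M D p ≫ bendDown M D q) =
      η_ M D ≫ M ◁ partialTrace J J' (p ≫ q) ≫ cap M D := by
  calc
    _ = 𝟙 _ ⊗≫ (𝟙_ C ◁ η_ J J' ≫ η_ M D ▷ (J ⊗ J')) ⊗≫ M ◁ (p ≫ q) ▷ J' ⊗≫
          (cap M D ▷ (J ⊗ J') ≫ 𝟙_ C ◁ cap J J') ⊗≫ 𝟙 _ := by
      simp only [unitTrace, bendUp, bendDown, tensorLeftHomEquiv, Equiv.coe_fn_mk]; monoidal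
    _ = 𝟙 _ ⊗≫ (η_ M D ▷ 𝟙_ C ≫ (M ⊗ D) ◁ η_ J J') ⊗≫ M ◁ (p ≫ q) ▷ J' ⊗≫
          ((M ⊗ D) ◁ cap J J' ≫ cap M D ▷ 𝟙_ C) ⊗≫ 𝟙 _ := by
      rw [whisker_exchange (η_ M D), whisker_exchange (cap M D)]
    _ = _ := by rw [partialTrace]; monoidal

/-- The self-braiding of the unit is trivial, so θ is idempotent on the unit, and it is invertible.
-/
theorem twist_unit : (RibbonCategory.twist (𝟙_ C)).hom = 𝟙 _ := by
  have h := RibbonCategory.twist_tensor (𝟙_ C) (𝟙_ C)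
  have hn := RibbonCategory.twist_naturality (λ_ (𝟙_ C)).hom
  have hb : (β_ (𝟙_ C) (𝟙_ C)).hom = 𝟙 _ := by
    rw [braiding_tensorUnit_right]; monoidal
  rw [h, hb, Category.comp_id, Category.comp_id, MonoidalCategory.tensorHom_def, Category.assoc,
    leftUnitor_naturality, unitors_equal, rightUnitor_naturality_assoc] at hn
  have h2 := (cancel_epi _).1 hn
  rwa [eq_comm, ← cancel_epi (RibbonCategory.twist (𝟙_ C)).hom, Category.comp_id]

/-- Naturality of the twist along the evaluation X* ⊗ X ⟶ 𝟙, with trivial twist on the unit and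
θ_{X*} = (θ_X)*. It shows that the opposite evaluation survives reversing the braiding and inverting
the twist. -/
theorem braiding_inv_comp_evaluation (X : C) :
    (β_ (Xᘁ) X).inv ≫ ε_ X (Xᘁ) = (RibbonCategory.twist X).hom ▷ (Xᘁ) ≫ cap X (Xᘁ) := by
  have h3 : (RibbonCategory.twist X).homᘁ ▷ X ≫ ε_ X (Xᘁ) =
      (Xᘁ) ◁ (RibbonCategory.twist X).hom ≫ ε_ X (Xᘁ) := rightAdjointMate_comp_evaluation _
  have h := RibbonCategory.twist_naturality (ε_ X (Xᘁ))
  rw [twist_unit, Category.comp_id, RibbonCategory.twist_tensor, RibbonCategory.twist_dual] at h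
  rw [Iso.inv_comp_eq]
  conv_lhs => rw [h]
  rw [cap]
  simp only [Category.assoc]
  rw [braiding_naturality_assoc, MonoidalCategory.tensorHom_def, Category.assoc,
    braiding_naturality_right_assoc, h3]
  simp only [braiding_naturality_left_assoc]

theorem twist_inv_naturality {X Y : C} (f : X ⟶ Y) :
    f ≫ (RibbonCategory.twist Y).inv = (RibbonCategory.twist X).inv ≫ f := by
  rw [Iso.comp_inv_eq, Category.assoc, RibbonCategory.twist_naturality, Iso.inv_hom_id_assoc]

theorem twist_inv_tensor (X Y : C) :
    (RibbonCategory.twist (X ⊗ Y)).inv =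
      ((RibbonCategory.twist X).inv ⊗ₘ (RibbonCategory.twist Y).inv) ≫
        (β_ Y X).inv ≫ (β_ X Y).inv := by
  rw [← cancel_epi (RibbonCategory.twist (X ⊗ Y)).hom, Iso.hom_inv_id, RibbonCategory.twist_tensor]
  simp

theorem twist_inv_dual (X : C) :
    (RibbonCategory.twist (Xᘁ)).inv = (RibbonCategory.twist X).invᘁ := by
  rw [← cancel_epi (RibbonCategory.twist (Xᘁ)).hom, Iso.hom_inv_id,
    RibbonCategory.twist_dual, ← comp_rightAdjointMate, Iso.inv_hom_id, rightAdjointMate_id]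

/-- The ribbon structure of the reversed braiding. -/
@[reducible]
def reverseRibbon : @RibbonCategory C _ _ (reverseBraiding C) _ :=
  @RibbonCategory.mk C _ _ (reverseBraiding C) _ (fun X => (RibbonCategory.twist X).symm)
    (fun f => twist_inv_naturality f) (fun X Y => twist_inv_tensor X Y) (fun X => twist_inv_dual X)

theorem cap_reverse (X : C) :
    @cap C _ _ (reverseBraiding C) _ reverseRibbon X (Xᘁ) _ = cap X (Xᘁ) := by
  change (RibbonCategory.twist X).inv ▷ (Xᘁ) ≫ (β_ (Xᘁ) X).inv ≫ ε_ X (Xᘁ) = _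
  rw [braiding_inv_comp_evaluation, ← comp_whiskerRight_assoc, Iso.inv_hom_id, id_whiskerRight,
    Category.id_comp]

end Ribbon

/-! ### Semisimplicity and Schur's lemma -/

section Semisimple

variable {C : Type u} [Category.{v} C] [Abelian C] {ι : Type*} (X : SimpleReps C ι)

instance SimpleReps.simple_obj (i : ι) : Simple (X.obj i) := X.simple i

theorem SimpleReps.hom_eq_zero {i j : ι} (h : i ≠ j) (f : X.obj i ⟶ X.obj j) : f = 0 := by
  by_contra hf
  have := isIso_of_hom_simple hf
  exact h (X.eq_of_iso i j ⟨asIso f⟩)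

/-- A decomposition of `Z` into copies of the representatives of the simple objects. -/
structure Decomposition (Z : C) [Fintype ι] where
  /-- the set of copies of `X_j` -/
  index : ι → Type
  [fintype : ∀ j, Fintype (index j)]
  [decidableEq : ∀ j, DecidableEq (index j)]
  /-- the inclusions -/
  incl : ∀ j, index j → (X.obj j ⟶ Z)
  /-- the projections -/
  proj : ∀ j, index j → (Z ⟶ X.obj j)
  incl_proj : ∀ j a b, incl j a ≫ proj j b = if a = b then 𝟙 _ else 0
  total : ∑ j, ∑ a, proj j a ≫ incl j a = 𝟙 Z

attribute [instance] Decomposition.fintype Decomposition.decidableEq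

variable [Fintype ι]

variable {X} {Z : C} (P : Decomposition X Z)

theorem Decomposition.hom_eq_sum {j : ι} (f : X.obj j ⟶ Z) :
    f = ∑ a, (f ≫ P.proj j a) ≫ P.incl j a := by
  conv_lhs => rw [← Category.comp_id f, ← P.total, Preadditive.comp_sum]
  rw [Finset.sum_eq_single j]
  · simp [Preadditive.comp_sum]
  · intro j' _ hj
    rw [Preadditive.comp_sum]
    refine Finset.sum_eq_zero fun a _ => ?_
    rw [← Category.assoc, X.hom_eq_zero hj.symm (f ≫ P.proj j' a), zero_comp]
  · simp

theorem Decomposition.hom_eq_sum' {j : ι} (f : Z ⟶ X.obj j) :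
    f = ∑ a, P.proj j a ≫ (P.incl j a ≫ f) := by
  conv_lhs => rw [← Category.id_comp f, ← P.total, Preadditive.sum_comp]
  rw [Finset.sum_eq_single j]
  · simp [Preadditive.sum_comp]
  · intro j' _ hj
    rw [Preadditive.sum_comp]
    refine Finset.sum_eq_zero fun a _ => ?_
    rw [Category.assoc, X.hom_eq_zero hj (P.incl j' a ≫ f), comp_zero]
  · simp

variable (k : Type w) [Field k] [Linear k C]

variable (X) in
theorem nonempty_decomposition [MonoidalCategory C] [IsFusion k C] (Z : C) :
    Nonempty (Decomposition X Z) := by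
  classical
  obtain ⟨n, S, b, hS, ⟨hb⟩, ⟨e⟩⟩ := IsFusion.semisimple k Z
  choose i φ using fun a => X.exists_iso (S a) (hS a)
  replace φ := fun a => (φ a).some
  -- The copies of X_j are the summands of class j; `eqToHom` transports along the equation of
  -- indices.
  refine ⟨{ index := fun j => {a : Fin n // i a = j}
            incl := fun j a => eqToHom (by rw [a.2]) ≫ (φ a.1).inv ≫ b.ι a.1 ≫ e.inv
            proj := fun j a => e.hom ≫ b.π a.1 ≫ (φ a.1).hom ≫ eqToHom (by rw [a.2])
            incl_proj := ?_
            total := ?_ }⟩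
  · rintro j ⟨a, rfl⟩ ⟨a', h'⟩
    by_cases h : a = a'
    · subst h; simp
    · have := bicone_ι_π_ne b h
      simp [h, reassoc_of% this]
  · have ht : ∑ a, b.π a ≫ b.ι a = 𝟙 b.pt := IsBilimit.total hb
    calc
      _ = ∑ a : Fin n, e.hom ≫ (b.π a ≫ b.ι a) ≫ e.inv := by
        rw [← Fintype.sum_sigma']
        refine Fintype.sum_equiv (Equiv.sigmaFiberEquiv i) _ _ ?_
        rintro ⟨j, a, rfl⟩
        simp [Equiv.sigmaFiberEquiv]
      _ = _ := by
        rw [← Preadditive.comp_sum, ← Preadditive.sum_comp, ht]; simp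

variable [IsAlgClosed k] [MonoidalCategory C] [IsFusion k C]

/-- By Schur, the inclusions of the copies of X_j form a basis of Hom(X_j, Z). -/
theorem Decomposition.card_index (j : ι) :
    Fintype.card (P.index j) = Module.finrank k (X.obj j ⟶ Z) := by
  have li : LinearIndependent k (P.incl j) := by
    rw [Fintype.linearIndependent_iff]
    intro c hc b
    have h := congrArg (· ≫ P.proj j b) hc
    simp only [Preadditive.sum_comp, Linear.smul_comp, P.incl_proj, zero_comp, smul_ite, smul_zero,
      Finset.sum_ite_eq', Finset.mem_univ, if_true] at h
    exact (smul_eq_zero.1 h).resolve_right (id_nonzero _)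
  refine (Module.finrank_eq_card_basis (Module.Basis.mk li ?_)).symm
  intro f _
  rw [P.hom_eq_sum f]
  refine Submodule.sum_mem _ fun a _ => ?_
  obtain ⟨c, hc⟩ := endomorphism_simple_eq_smul_id k (f ≫ P.proj j a)
  rw [← hc, Linear.smul_comp, Category.id_comp]
  exact Submodule.smul_mem _ _ (Submodule.subset_span ⟨a, rfl⟩)

theorem Decomposition.card_index' (j : ι) :
    Fintype.card (P.index j) = Module.finrank k (Z ⟶ X.obj j) := by
  have li : LinearIndependent k (P.proj j) := by
    rw [Fintype.linearIndependent_iff]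
    intro c hc b
    have h := congrArg (P.incl j b ≫ ·) hc
    simp only [Preadditive.comp_sum, Linear.comp_smul, P.incl_proj, comp_zero, smul_ite, smul_zero,
      Finset.sum_ite_eq, Finset.mem_univ, if_true] at h
    exact (smul_eq_zero.1 h).resolve_right (id_nonzero _)
  refine (Module.finrank_eq_card_basis (Module.Basis.mk li ?_)).symm
  intro f _
  rw [P.hom_eq_sum' f]
  refine Submodule.sum_mem _ fun a _ => ?_
  obtain ⟨c, hc⟩ := endomorphism_simple_eq_smul_id k (P.incl j a ≫ f)
  rw [← hc, Linear.comp_smul, Category.comp_id]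
  exact Submodule.smul_mem _ _ (Submodule.subset_span ⟨a, rfl⟩)

variable (X)

theorem finrank_hom_comm (j : ι) (Z : C) :
    Module.finrank k (Z ⟶ X.obj j) = Module.finrank k (X.obj j ⟶ Z) := by
  obtain ⟨P⟩ := nonempty_decomposition X k Z
  rw [← P.card_index k, ← P.card_index' k]

theorem exists_retraction (X : SimpleReps C ι) (k : Type w) [Field k] [Linear k C] [IsFusion k C]
    {S Z : C} [Simple S] (f : S ⟶ Z) (hf : f ≠ 0) :
    ∃ r : Z ⟶ S, f ≫ r = 𝟙 S := by
  obtain ⟨P⟩ := nonempty_decomposition X k Z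
  have : ∃ j a, f ≫ P.proj j a ≠ 0 := by
    by_contra! h
    apply hf
    rw [← Category.comp_id f, ← P.total, Preadditive.comp_sum]
    refine Finset.sum_eq_zero fun j _ => ?_
    rw [Preadditive.comp_sum]
    refine Finset.sum_eq_zero fun a _ => ?_
    rw [← Category.assoc, h, zero_comp]
  obtain ⟨j, a, h⟩ := this
  have := isIso_of_hom_simple h
  exact ⟨P.proj j a ≫ inv (f ≫ P.proj j a), by rw [← Category.assoc, IsIso.hom_inv_id]⟩

/-- An object is determined to be simple by its endomorphisms being scalar. -/
theorem exists_iso_of_forall_smul_id (hid : 𝟙 Z ≠ 0) (h : ∀ f : Z ⟶ Z, ∃ c : k, c • 𝟙 Z = f) :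
    ∃ j, Nonempty (X.obj j ≅ Z) := by
  obtain ⟨P⟩ := nonempty_decomposition X k Z
  have : ∃ j, Nonempty (P.index j) := by
    by_contra! h
    apply hid
    rw [← P.total]
    exact Finset.sum_eq_zero fun j _ => by simp
  obtain ⟨j, ⟨a⟩⟩ := this
  -- The idempotent of one summand is a scalar; it fixes a nonzero inclusion, so the scalar is 1 and
  -- the summand is all of Z.
  obtain ⟨c, hc⟩ := h (P.proj j a ≫ P.incl j a)
  have h1 : P.incl j a ≫ P.proj j a = 𝟙 _ := by simp [P.incl_proj]
  have h2 : c • P.incl j a = P.incl j a := by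
    have h3 := congrArg (P.incl j a ≫ ·) hc
    simpa [reassoc_of% h1] using h3
  have h4 : P.incl j a ≠ 0 := by
    intro h
    rw [h, zero_comp] at h1
    exact id_nonzero _ h1.symm
  have h5 : c = 1 := by
    have : (c - 1) • P.incl j a = 0 := by rw [sub_smul, h2, one_smul, sub_self]
    exact sub_eq_zero.1 ((smul_eq_zero.1 this).resolve_right h4)
  refine ⟨j, ⟨⟨P.incl j a, P.proj j a, h1, ?_⟩⟩⟩
  rw [← hc, h5, one_smul]

/-! ### Duals of simple objects -/

section Dual

variable [MonoidalPreadditive C] [MonoidalLinear k C] [RightRigidCategory C]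

/-- Duality identifies endomorphisms of S* with those of S, where Schur's lemma applies. -/
theorem rightDual_endomorphism_eq_smul_id (S : C) [Simple S] (f : (Sᘁ : C) ⟶ (Sᘁ : C)) :
    ∃ c : k, c • 𝟙 (Sᘁ : C) = f := by
  let w := tensorLeftHomEquiv S S (Sᘁ) (𝟙_ C) (f ▷ S ≫ ε_ S (Sᘁ))
  obtain ⟨c, hc⟩ := endomorphism_simple_eq_smul_id k (w ≫ (ρ_ S).hom)
  have hw : w = c • (ρ_ S).inv := by
    have := congrArg (· ≫ (ρ_ S).inv) hc
    simpa using this.symm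
  have he : f ▷ S ≫ ε_ S (Sᘁ) = c • ε_ S (Sᘁ) := by
    rw [← (tensorLeftHomEquiv S S (Sᘁ) (𝟙_ C)).symm_apply_apply (f ▷ S ≫ ε_ S (Sᘁ))]
    change (tensorLeftHomEquiv S S (Sᘁ) (𝟙_ C)).symm w = _
    rw [hw]
    simp only [tensorLeftHomEquiv, Equiv.coe_fn_symm_mk, MonoidalLinear.whiskerLeft_smul,
      Linear.smul_comp]
    congr 1
    monoidal
  have hf := tensorRightHomEquiv_whiskerRight_comp_evaluation f
  have hi := tensorRightHomEquiv_whiskerRight_comp_evaluation (X := S) (c • 𝟙 (Sᘁ : C))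
  refine ⟨c, ?_⟩
  rw [← cancel_mono (λ_ (Sᘁ : C)).inv, ← hf, ← hi, he]
  simp

theorem exists_iso_rightDual (k : Type w) [Field k] [IsAlgClosed k] [Linear k C] [IsFusion k C]
    [MonoidalLinear k C] (S : C) [Simple S] : ∃ j, Nonempty (X.obj j ≅ (Sᘁ : C)) := by
  refine exists_iso_of_forall_smul_id X k ?_ (rightDual_endomorphism_eq_smul_id k S)
  intro h
  have hz := ExactPairing.evaluation_coevaluation S (Sᘁ)
  have h0 : ε_ S (Sᘁ) = 0 := by
    rw [← Category.id_comp (ε_ S (Sᘁ)), ← id_whiskerRight, h]; simp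
  rw [h0] at hz
  simp only [MonoidalPreadditive.whiskerLeft_zero, comp_zero] at hz
  apply id_nonzero S
  rw [← cancel_epi (λ_ S).hom, ← cancel_mono (ρ_ S).inv]
  simpa using hz.symm

end Dual

end Semisimple

/-! ### The trace form, linking numbers, twist scalars and dimensions -/

section Trace

variable (k : Type w) [Field k] [IsAlgClosed k] {C : Type u} [Category.{v} C] [Abelian C]
  [Linear k C] [MonoidalCategory C] [IsFusion k C]

theorem unit_smul_id_injective : Function.Injective fun c : k => c • 𝟙 (𝟙_ C) :=
  smul_left_injective k (id_nonzero _)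

variable [BraidedCategory C] [RightRigidCategory C] [RibbonCategory C]

theorem trace_smul_id {X : C} (f : X ⟶ X) : trace k f • 𝟙 (𝟙_ C) = unitTrace X (Xᘁ) f := by
  rw [trace, unitScalar_smul, unitTrace, cap]
  simp

theorem trace_eq_of_unitTrace_eq {X Y : C} {f : X ⟶ X} {g : Y ⟶ Y}
    (h : unitTrace X (Xᘁ) f = unitTrace Y (Yᘁ) g) : trace k f = trace k g :=
  unit_smul_id_injective k (C := C) (by simp only [trace_smul_id, h])

theorem trace_comp_comm {X Y : C} (f : X ⟶ Y) (g : Y ⟶ X) : trace k (f ≫ g) = trace k (g ≫ f) :=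
  trace_eq_of_unitTrace_eq k (unitTrace_comp_comm _ _ _ _ f g)

theorem trace_tensor {Y L : C} (f : Y ⊗ L ⟶ Y ⊗ L) :
    trace k f = trace k (partialTrace L (Lᘁ) f) := by
  apply trace_eq_of_unitTrace_eq
  have h := unitTrace_comp_comm (Y ⊗ L) (Y ⊗ L) ((Y ⊗ L)ᘁ) (Lᘁ ⊗ Yᘁ) f (𝟙 _)
  rwa [Category.comp_id, Category.id_comp, unitTrace_tensor] at h

theorem trace_conj {X Y : C} (e : X ≅ Y) (f : Y ⟶ Y) : trace k (e.hom ≫ f ≫ e.inv) = trace k f := by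
  rw [trace_comp_comm, Category.assoc, e.inv_hom_id, Category.comp_id]

theorem dim_eq_of_iso {X Y : C} (e : X ≅ Y) : dim k X = dim k Y := by
  rw [dim, dim, ← trace_conj k e, Category.id_comp, e.hom_inv_id]

theorem dim_rightDual (X : C) : dim k (Xᘁ : C) = dim k X :=
  trace_eq_of_unitTrace_eq k (unitTrace_rightDual_id X)

/-- The trace of the double braiding. -/
def linking (Y L : C) : k := trace k (doubleBraiding Y L)

theorem linking_comm (Y L : C) : linking k Y L = linking k L Y := trace_comp_comm k _ _

theorem linking_eq_of_iso {Y Y' L L' : C} (e : Y ≅ Y') (e' : L ≅ L') :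
    linking k Y L = linking k Y' L' := by
  rw [linking, linking, ← trace_conj k (e ⊗ᵢ e')]
  congr 1
  rw [← Category.assoc, tensorIso_hom, doubleBraiding_naturality, Category.assoc, ← tensorIso_hom,
    Iso.hom_inv_id, Category.comp_id]

/-- The scalar by which the twist acts on a simple object. -/
def twistScalar (S : C) [Simple S] : k :=
  Classical.choose (endomorphism_simple_eq_smul_id k (RibbonCategory.twist S).hom)

theorem twistScalar_smul (S : C) [Simple S] :
    twistScalar k S • 𝟙 S = (RibbonCategory.twist S).hom :=
  Classical.choose_spec (endomorphism_simple_eq_smul_id k (RibbonCategory.twist S).hom)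

variable [MonoidalPreadditive C] [MonoidalLinear k C]

/-- The trace as a linear form. -/
def traceLinear (X : C) : (X ⟶ X) →ₗ[k] k where
  toFun f := trace k f
  map_add' f g := unit_smul_id_injective k (C := C) (by
    simp only [add_smul, trace_smul_id, unitTrace, MonoidalPreadditive.add_whiskerRight,
      Preadditive.comp_add, Preadditive.add_comp])
  map_smul' c f := unit_smul_id_injective k (C := C) (by
    simp only [smul_assoc, trace_smul_id, unitTrace, MonoidalLinear.smul_whiskerRight,
      Linear.comp_smul, Linear.smul_comp, RingHom.id_apply])

theorem traceLinear_apply {X : C} (f : X ⟶ X) : traceLinear k X f = trace k f := rfl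

theorem trace_sum {X : C} {κ : Type*} (s : Finset κ) (f : κ → (X ⟶ X)) :
    trace k (∑ i ∈ s, f i) = ∑ i ∈ s, trace k (f i) := by
  simp only [← traceLinear_apply, map_sum]

theorem trace_smul (c : k) {X : C} (f : X ⟶ X) : trace k (c • f) = c * trace k f := by
  rw [← traceLinear_apply, map_smul, smul_eq_mul, traceLinear_apply]

theorem trace_zero (X : C) : trace k (0 : X ⟶ X) = 0 := map_zero (traceLinear k X)

theorem trace_sub {X : C} (f g : X ⟶ X) : trace k (f - g) = trace k f - trace k g :=
  map_sub (traceLinear k X) f g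

/-- A link with `L` around a simple object multiplies traces by a scalar. -/
theorem dim_mul_trace_whiskerRight_comp_doubleBraiding (Y M L : C) [Simple Y]
    (g : Y ⊗ M ⟶ Y ⊗ M) :
    dim k Y * trace k (g ▷ L ≫ (α_ Y M L).hom ≫ doubleBraiding Y (M ⊗ L) ≫ (α_ Y M L).inv) =
      linking k Y L * trace k (g ≫ doubleBraiding Y M) := by
  -- A loop L around the simple Y is a scalar c, with S(Y, L) = c d_Y; the factor d_Y in the
  -- statement avoids a division.
  obtain ⟨c, hc⟩ := endomorphism_simple_eq_smul_id k (partialTrace L (Lᘁ) (doubleBraiding Y L))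
  have hS : linking k Y L = c * dim k Y := by
    rw [linking, trace_tensor, ← hc, trace_smul, dim]
  have hp : partialTrace L (Lᘁ) ((α_ M Y L).hom ≫ M ◁ doubleBraiding Y L ≫ (α_ M Y L).inv) =
      c • 𝟙 (M ⊗ Y) := by
    rw [partialTrace_whiskerLeft, ← hc, MonoidalLinear.whiskerLeft_smul, whiskerLeft_id]
  rw [hS, doubleBraiding_tensor, trace_tensor, ← comp_whiskerRight_assoc]
  have := partialTrace_whiskerRight L (Lᘁ) (g ≫ (β_ Y M).hom)
    ((α_ M Y L).hom ≫ M ◁ doubleBraiding Y L ≫ (α_ M Y L).inv) (β_ M Y).hom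
  simp only [Category.assoc] at this
  rw [this, hp]
  simp only [Linear.smul_comp, Linear.comp_smul, Category.id_comp, trace_smul, doubleBraiding]
  ring

theorem linking_mul_linking (Y M L : C) [Simple Y] :
    linking k Y M * linking k Y L = dim k Y * linking k Y (M ⊗ L) := by
  have h := dim_mul_trace_whiskerRight_comp_doubleBraiding k Y M L (𝟙 _)
  rw [id_whiskerRight, Category.id_comp, Category.id_comp, trace_conj] at h
  rw [mul_comm]
  exact h.symm

section Simples

variable {ι : Type*} [Fintype ι] (X : SimpleReps C ι)

theorem linking_eq_sum (Y Z : C) :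
    linking k Y Z = ∑ j, (Module.finrank k (X.obj j ⟶ Z) : k) * linking k Y (X.obj j) := by
  obtain ⟨P⟩ := nonempty_decomposition X k Z
  have h : doubleBraiding Y Z =
      ∑ j, ∑ a, Y ◁ P.proj j a ≫ doubleBraiding Y (X.obj j) ≫ Y ◁ P.incl j a := by
    simp only [← doubleBraiding_naturality_right, ← whiskerLeft_comp_assoc]
    simp only [← Preadditive.sum_comp, ← whiskerLeft_sum, P.total, whiskerLeft_id, Category.id_comp]
  rw [linking, h, trace_sum]
  refine Finset.sum_congr rfl fun j _ => ?_
  rw [trace_sum, ← P.card_index k, ← nsmul_eq_mul]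
  refine (Finset.sum_congr rfl fun a _ => ?_).trans (Finset.sum_const _)
  rw [trace_comp_comm, Category.assoc, ← whiskerLeft_comp, P.incl_proj, if_pos rfl, whiskerLeft_id,
    Category.comp_id, linking]

theorem twistScalar_ne_zero (S : C) [Simple S] : twistScalar k S ≠ 0 := by
  intro h
  have h1 := twistScalar_smul k S
  rw [h, zero_smul] at h1
  have h2 := (RibbonCategory.twist S).hom_inv_id
  rw [← h1, zero_comp] at h2
  exact id_nonzero S h2.symm

theorem twistScalar_eq_of_iso {S T : C} [Simple S] [Simple T] (e : S ≅ T) :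
    twistScalar k S = twistScalar k T := by
  have h := RibbonCategory.twist_naturality e.hom
  rw [← twistScalar_smul k S, ← twistScalar_smul k T, Linear.comp_smul, Linear.smul_comp,
    Category.comp_id, Category.id_comp] at h
  have he : e.hom ≠ 0 := (isIso_iff_nonzero _).1 inferInstance
  exact (smul_left_injective k he h).symm

theorem twistScalar_rightDual (S : C) [Simple S] [Simple (Sᘁ : C)] :
    twistScalar k (Sᘁ : C) = twistScalar k S := by
  have h := RibbonCategory.twist_dual S
  rw [← twistScalar_smul k S, ← twistScalar_smul k (Sᘁ : C)] at h
  have hm : (twistScalar k S • 𝟙 S)ᘁ = twistScalar k S • 𝟙 (Sᘁ : C) := by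
    rw [← rightAdjointMate_id]
    simp only [rightAdjointMate, MonoidalLinear.smul_whiskerRight, MonoidalLinear.whiskerLeft_smul,
      Linear.comp_smul, Linear.smul_comp]
  rw [hm] at h
  exact smul_left_injective k (id_nonzero (Sᘁ : C)) h

/-- The trace of the twist on S ⊗ T, computed by the balancing axiom and by decomposing S ⊗ T. It
expresses S-entries through data invariant under duality. -/
theorem linking_mul_twistScalar (S T : C) [Simple S] [Simple T] :
    linking k S T * (twistScalar k S * twistScalar k T) =
      ∑ j, (Module.finrank k (X.obj j ⟶ S ⊗ T) : k) *
        (twistScalar k (X.obj j) * dim k (X.obj j)) := by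
  obtain ⟨P⟩ := nonempty_decomposition X k (S ⊗ T)
  have h1 : trace k (RibbonCategory.twist (S ⊗ T)).hom =
      linking k S T * (twistScalar k S * twistScalar k T) := by
    rw [RibbonCategory.twist_tensor, ← twistScalar_smul k S, ← twistScalar_smul k T,
      MonoidalCategory.tensorHom_def]
    simp only [MonoidalLinear.smul_whiskerRight, MonoidalLinear.whiskerLeft_smul,
      Linear.comp_smul, Linear.smul_comp, id_whiskerRight, whiskerLeft_id, Category.id_comp,
      trace_smul]
    rw [linking, doubleBraiding]; ring
  have h : (RibbonCategory.twist (S ⊗ T)).hom =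
      ∑ j, ∑ a, P.proj j a ≫ (RibbonCategory.twist (X.obj j)).hom ≫ P.incl j a := by
    simp only [← RibbonCategory.twist_naturality]
    simp only [← Category.assoc, ← Preadditive.sum_comp, P.total, Category.id_comp]
  rw [← h1, h, trace_sum]
  refine Finset.sum_congr rfl fun j _ => ?_
  rw [trace_sum, ← P.card_index k, ← nsmul_eq_mul]
  refine (Finset.sum_congr rfl fun a _ => ?_).trans (Finset.sum_const _)
  rw [trace_comp_comm, Category.assoc, P.incl_proj, if_pos rfl, Category.comp_id,
    ← twistScalar_smul k, trace_smul, dim]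

/-- The coevaluation is nonzero, hence split by semisimplicity. By Schur every map S ⊗ S* ⟶ 𝟙 is a
multiple of the opposite evaluation, so if d_S were 0 no retraction could exist. -/
theorem dim_ne_zero (X : SimpleReps C ι) (S : C) [Simple S] : dim k S ≠ 0 := by
  intro hd
  let p : ExactPairing (Sᘁ : C) S := exactPairing_swap S (Sᘁ)
  have h0 : η_ S (Sᘁ) ≫ cap S (Sᘁ) = 0 := by
    have := trace_smul_id k (𝟙 S)
    rw [← dim, hd, zero_smul, unitTrace, id_whiskerRight, Category.id_comp] at this
    exact this.symm
  have hη : η_ S (Sᘁ) ≠ 0 := by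
    intro h
    have hz := ExactPairing.evaluation_coevaluation S (Sᘁ)
    rw [h] at hz
    simp only [MonoidalPreadditive.zero_whiskerRight, zero_comp] at hz
    apply id_nonzero S
    rw [← cancel_epi (λ_ S).hom, ← cancel_mono (ρ_ S).inv]
    simpa using hz.symm
  obtain ⟨r, hr⟩ := exists_retraction X k _ hη
  let w := tensorRightHomEquiv S (Sᘁ) S (𝟙_ C) r
  obtain ⟨c, hc⟩ := endomorphism_simple_eq_smul_id k (w ≫ (λ_ S).hom)
  have hw : w = c • (λ_ S).inv := by
    have := congrArg (· ≫ (λ_ S).inv) hc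
    simpa using this.symm
  have e2 : ε_ (Sᘁ) S = (β_ S (Sᘁ)).hom ≫ ε_ S (Sᘁ) := rfl
  have hr' : r = c • ε_ (Sᘁ) S := by
    rw [← (tensorRightHomEquiv S (Sᘁ) S (𝟙_ C)).symm_apply_apply r]
    change (tensorRightHomEquiv S (Sᘁ) S (𝟙_ C)).symm w = _
    rw [hw]
    simp only [tensorRightHomEquiv, Equiv.coe_fn_symm_mk, MonoidalLinear.smul_whiskerRight,
      Linear.smul_comp]
    congr 1
    monoidal
  have hcap : cap S (Sᘁ) = twistScalar k S • ε_ (Sᘁ) S := by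
    rw [cap, e2, ← twistScalar_smul k S, MonoidalLinear.smul_whiskerRight, Linear.smul_comp,
      id_whiskerRight, Category.id_comp]
  rw [hcap, Linear.comp_smul] at h0
  have h1 := (smul_eq_zero.1 h0).resolve_left (twistScalar_ne_zero k S)
  rw [hr', Linear.comp_smul, h1, smul_zero] at hr
  exact id_nonzero _ hr.symm

/-- The trace form is nondegenerate. -/
theorem eq_zero_of_forall_trace_comp_eq_zero (X : SimpleReps C ι) {A B : C} (f : A ⟶ B)
    (h : ∀ g : B ⟶ A, trace k (f ≫ g) = 0) : f = 0 := by
  by_contra hf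
  obtain ⟨P⟩ := nonempty_decomposition X k A
  have : ∃ j a, P.incl j a ≫ f ≠ 0 := by
    by_contra! h
    apply hf
    rw [← Category.id_comp f, ← P.total, Preadditive.sum_comp]
    refine Finset.sum_eq_zero fun j _ => ?_
    rw [Preadditive.sum_comp]
    refine Finset.sum_eq_zero fun a _ => ?_
    rw [Category.assoc, h, comp_zero]
  obtain ⟨j, a, hja⟩ := this
  obtain ⟨r, hr⟩ := exists_retraction X k _ hja
  have h1 := h (r ≫ P.incl j a)
  rw [← Category.assoc, trace_comp_comm, ← Category.assoc, hr] at h1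
  exact dim_ne_zero k X (X.obj j) h1

end Simples

end Trace

/-! ### The handle slide and the killing property -/

section HandleSlide

variable (k : Type w) [Field k] [IsAlgClosed k] {C : Type u} [Category.{v} C] [Abelian C]
  [Linear k C] [MonoidalCategory C] [IsFusion k C]
  [BraidedCategory C] [RightRigidCategory C] [RibbonCategory C]
  [MonoidalPreadditive C] [MonoidalLinear k C]

theorem dim_tensor (Y L : C) : dim k (Y ⊗ L) = dim k Y * dim k L := by
  have h : partialTrace L (Lᘁ) (𝟙 (Y ⊗ L)) = dim k L • 𝟙 Y := by
    have h1 := trace_smul_id k (𝟙 L)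
    rw [← dim, unitTrace, id_whiskerRight, Category.id_comp] at h1
    calc
      _ = 𝟙 _ ⊗≫ Y ◁ (η_ L (Lᘁ) ≫ cap L (Lᘁ)) ⊗≫ 𝟙 _ := by rw [partialTrace]; monoidal
      _ = _ := by
        rw [← h1, MonoidalLinear.whiskerLeft_smul]
        simp [monoidalComp]
  rw [dim, trace_tensor, h, trace_smul, mul_comm]
  rfl

variable {ι : Type*} [Fintype ι] (X : SimpleReps C ι)

theorem eq_smul_id_of_forall {Z : C} (R : Z ⟶ Z) (d : k)
    (h : ∀ j (f : X.obj j ⟶ Z), f ≫ R = d • f) : R = d • 𝟙 Z := by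
  obtain ⟨P⟩ := nonempty_decomposition X k Z
  rw [← Category.id_comp R, ← P.total, Preadditive.sum_comp, Finset.smul_sum]
  refine Finset.sum_congr rfl fun j _ => ?_
  rw [Preadditive.sum_comp, Finset.smul_sum]
  refine Finset.sum_congr rfl fun a _ => ?_
  rw [Category.assoc, h, Linear.comp_smul]

section Bend

variable (M : C) [Simple M] (P : ∀ j, Decomposition X ((Mᘁ : C) ⊗ X.obj j))

/-- The composite is a scalar s on X_j, and the partial trace over X_j of the unbent composite is a
scalar r on M*. Comparing traces gives s d_j = r d_M = δ_{ab} d_l. -/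
theorem bendUp_proj_comp_bendDown_incl (j l : ι) (a b : (P j).index l) :
    bendUp M (Mᘁ) ((P j).proj l a) ≫ bendDown M (Mᘁ) ((P j).incl l b) =
      if a = b then (dim k (X.obj l) / dim k (X.obj j)) • 𝟙 (X.obj j) else 0 := by
  obtain ⟨s, hs⟩ := endomorphism_simple_eq_smul_id k
    (bendUp M (Mᘁ) ((P j).proj l a) ≫ bendDown M (Mᘁ) ((P j).incl l b))
  obtain ⟨r, hr⟩ := rightDual_endomorphism_eq_smul_id k M
    (partialTrace (X.obj j) ((X.obj j)ᘁ) ((P j).proj l a ≫ (P j).incl l b))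
  have h1 : s * dim k (X.obj j) = r * dim k M := by
    apply unit_smul_id_injective k (C := C)
    simp only [dim, ← trace_smul, trace_smul_id]
    rw [hs, unitTrace_bendUp_comp_bendDown, ← hr, unitTrace, MonoidalLinear.whiskerLeft_smul,
      MonoidalLinear.smul_whiskerRight, whiskerLeft_id, id_whiskerRight]
  have h2 : r * dim k M = if a = b then dim k (X.obj l) else 0 := by
    rw [← dim_rightDual, dim, ← trace_smul, hr, ← trace_tensor, trace_comp_comm, (P j).incl_proj]
    by_cases hab : a = b
    · subst hab; simp [dim]
    · rw [if_neg hab, if_neg (Ne.symm hab), trace_zero]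
  have h3 : s = (if a = b then dim k (X.obj l) else 0) / dim k (X.obj j) := by
    rw [← h2, ← h1, mul_div_cancel_right₀ _ (dim_ne_zero k X (X.obj j))]
  rw [← hs, h3]
  split_ifs <;> simp

/-- The bent projections span each Hom(X_j, M ⊗ X_l), and by the orthogonality above the bent
inclusions are dual to them up to d_l/d_j. So they resolve the identity of M ⊗ X_l. -/
theorem sum_bendDown_incl_comp_bendUp_proj (l : ι) :
    ∑ j, ∑ a, dim k (X.obj j) •
        (bendDown M (Mᘁ) ((P j).incl l a) ≫ bendUp M (Mᘁ) ((P j).proj l a)) =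
      dim k (X.obj l) • 𝟙 (M ⊗ X.obj l) := by
  apply eq_smul_id_of_forall k X
  have key : ∀ j (a : (P j).index l), bendUp M (Mᘁ) ((P j).proj l a) ≫
      ∑ j, ∑ a, dim k (X.obj j) •
        (bendDown M (Mᘁ) ((P j).incl l a) ≫ bendUp M (Mᘁ) ((P j).proj l a)) =
      dim k (X.obj l) • bendUp M (Mᘁ) ((P j).proj l a) := by
    intro j a
    rw [Preadditive.comp_sum, Finset.sum_eq_single j]
    · rw [Preadditive.comp_sum, Finset.sum_eq_single a]
      · rw [Linear.comp_smul, ← Category.assoc, bendUp_proj_comp_bendDown_incl k X M P, if_pos rfl,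
          Linear.smul_comp, Category.id_comp, smul_smul,
          mul_div_cancel₀ _ (dim_ne_zero k X (X.obj j))]
      · intro b _ hb
        rw [Linear.comp_smul, ← Category.assoc, bendUp_proj_comp_bendDown_incl k X M P,
          if_neg hb.symm, zero_comp, smul_zero]
      · simp
    · intro j' _ hj
      rw [Preadditive.comp_sum]
      refine Finset.sum_eq_zero fun b _ => ?_
      rw [Linear.comp_smul, ← Category.assoc, X.hom_eq_zero hj.symm (_ ≫ _), zero_comp, smul_zero]
    · simp
  intro j f
  have hf : f = ∑ a, (bendUp M (Mᘁ) ((P j).proj l a ≫ ((P j).incl l a ≫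
      (tensorLeftHomEquiv (X.obj j) M (Mᘁ) (X.obj l)).symm f))) := by
    conv_lhs => rw [← (tensorLeftHomEquiv (X.obj j) M (Mᘁ) (X.obj l)).apply_symm_apply f,
      (P j).hom_eq_sum' ((tensorLeftHomEquiv (X.obj j) M (Mᘁ) (X.obj l)).symm f)]
    simp only [bendUp, tensorLeftHomEquiv, Equiv.coe_fn_mk, whiskerLeft_sum, Preadditive.comp_sum]
  rw [hf, Preadditive.sum_comp, Finset.smul_sum]
  refine Finset.sum_congr rfl fun a _ => ?_
  obtain ⟨c, hc⟩ := endomorphism_simple_eq_smul_id k ((P j).incl l a ≫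
      (tensorLeftHomEquiv (X.obj j) M (Mᘁ) (X.obj l)).symm f)
  have hb : bendUp M (Mᘁ) ((P j).proj l a ≫ (c • 𝟙 (X.obj l))) =
      c • bendUp M (Mᘁ) ((P j).proj l a) := by
    simp only [bendUp, tensorLeftHomEquiv, Equiv.coe_fn_mk, Linear.comp_smul, Category.comp_id,
      MonoidalLinear.whiskerLeft_smul]
  rw [← hc, hb, Linear.smul_comp, key, smul_comm]

theorem sum_bendUp_comp_bendDown (j : ι) {Y : C} (g : Y ⊗ M ⟶ Y ⊗ M) :
    ∑ l, ∑ a, Y ◁ bendUp M (Mᘁ) ((P j).proj l a) ≫ (α_ Y M (X.obj l)).inv ≫ g ▷ X.obj l ≫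
        (α_ Y M (X.obj l)).hom ≫ Y ◁ bendDown M (Mᘁ) ((P j).incl l a) =
      partialTrace M (Mᘁ) g ▷ X.obj j := by
  simp only [bendUp_comp_bendDown]
  rw [partialTrace_whiskerRight_eq, ← (P j).total]
  simp only [monoidalComp, whiskerLeft_sum, Preadditive.comp_sum, Preadditive.sum_comp]

end Bend

/-- Sliding a strand `M` over the weighted sum of loops around `Y`. -/
theorem sum_dim_mul_trace_whiskerRight (Y M : C) [Simple M] (g : Y ⊗ M ⟶ Y ⊗ M) :
    ∑ l, dim k (X.obj l) * trace k (g ▷ X.obj l ≫ (α_ Y M (X.obj l)).hom ≫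
        doubleBraiding Y (M ⊗ X.obj l) ≫ (α_ Y M (X.obj l)).inv) =
      ∑ j, dim k (X.obj j) *
        trace k (partialTrace M (Mᘁ) g ▷ X.obj j ≫ doubleBraiding Y (X.obj j)) := by
  have P := fun j => (nonempty_decomposition X k ((Mᘁ : C) ⊗ X.obj j)).some
  -- The resolution of the identity of M ⊗ X_l exchanges the weight d_l for d_j. Cyclicity then
  -- moves the bent projection to the front, where summing over l and a closes the strand M.
  have hl : ∀ l, dim k (X.obj l) • doubleBraiding Y (M ⊗ X.obj l) =
      ∑ j, ∑ a, dim k (X.obj j) • (Y ◁ bendDown M (Mᘁ) ((P j).incl l a) ≫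
        doubleBraiding Y (X.obj j) ≫ Y ◁ bendUp M (Mᘁ) ((P j).proj l a)) := by
    intro l
    calc
      _ = Y ◁ (dim k (X.obj l) • 𝟙 (M ⊗ X.obj l)) ≫ doubleBraiding Y (M ⊗ X.obj l) := by
        simp [MonoidalLinear.whiskerLeft_smul]
      _ = _ := by
        rw [← sum_bendDown_incl_comp_bendUp_proj k X M P l]
        simp only [whiskerLeft_sum, Preadditive.sum_comp, MonoidalLinear.whiskerLeft_smul,
          Linear.smul_comp, MonoidalCategory.whiskerLeft_comp, Category.assoc,
          doubleBraiding_naturality_right]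
  simp only [← sum_bendUp_comp_bendDown X M P, Preadditive.sum_comp, trace_sum, Finset.mul_sum]
  rw [Finset.sum_comm]
  refine Finset.sum_congr rfl fun l _ => ?_
  rw [← trace_smul, ← Linear.comp_smul, ← Linear.comp_smul, ← Linear.smul_comp, hl]
  simp only [Preadditive.sum_comp, Preadditive.comp_sum, trace_sum, Linear.smul_comp,
    Linear.comp_smul, trace_smul]
  refine Finset.sum_congr rfl fun j _ => Finset.sum_congr rfl fun a _ => ?_
  congr 1
  simp only [Category.assoc]
  have hcyc := trace_comp_comm k (g ▷ X.obj l ≫ (α_ Y M (X.obj l)).hom ≫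
    Y ◁ bendDown M (Mᘁ) ((P j).incl l a) ≫ doubleBraiding Y (X.obj j))
    (Y ◁ bendUp M (Mᘁ) ((P j).proj l a) ≫ (α_ Y M (X.obj l)).inv)
  simpa only [Category.assoc] using hcyc

/-- The two sides of the handle slide: on one the loop X_l factors off as a scalar, on the other the
partial trace of `g` is a scalar on Y. -/
theorem sum_dim_mul_linking_mul_trace (Y M : C) [Simple Y] [Simple M] (g : Y ⊗ M ⟶ Y ⊗ M) :
    (∑ l, dim k (X.obj l) * linking k Y (X.obj l)) * trace k (g ≫ doubleBraiding Y M) =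
      (∑ l, dim k (X.obj l) * linking k Y (X.obj l)) * trace k g := by
  have h := congrArg (dim k Y * ·) (sum_dim_mul_trace_whiskerRight k X Y M g)
  obtain ⟨c, hc⟩ := endomorphism_simple_eq_smul_id k (partialTrace M (Mᘁ) g)
  have hg : trace k g = c * dim k Y := by rw [trace_tensor, ← hc, trace_smul, dim]
  simp only [Finset.mul_sum, mul_left_comm (dim k Y),
    dim_mul_trace_whiskerRight_comp_doubleBraiding] at h
  rw [Finset.sum_mul, Finset.sum_mul]
  simp only [mul_assoc]
  rw [h]
  refine Finset.sum_congr rfl fun j _ => ?_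
  rw [← hc, MonoidalLinear.smul_whiskerRight, Linear.smul_comp, trace_smul, id_whiskerRight,
    Category.id_comp, ← linking, hg]
  ring

theorem isTransparent_of_sum_ne_zero (Y : C) [Simple Y]
    (h : ∑ l, dim k (X.obj l) * linking k Y (X.obj l) ≠ 0) : IsTransparent Y := by
  have hs : ∀ j, doubleBraiding Y (X.obj j) = 𝟙 _ := by
    intro j
    rw [← sub_eq_zero]
    apply eq_zero_of_forall_trace_comp_eq_zero k X
    intro g
    have hg := mul_left_cancel₀ h (sum_dim_mul_linking_mul_trace k X Y (X.obj j) g)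
    rw [trace_comp_comm, Preadditive.comp_sub, trace_sub, hg, Category.comp_id, sub_self]
  intro Z
  obtain ⟨P⟩ := nonempty_decomposition X k Z
  change doubleBraiding Y Z = _
  rw [← Category.id_comp (doubleBraiding Y Z), ← whiskerLeft_id, ← P.total]
  simp only [whiskerLeft_sum, Preadditive.sum_comp, MonoidalCategory.whiskerLeft_comp,
    Category.assoc, doubleBraiding_naturality_right, hs, Category.id_comp]

open Classical in
theorem sum_dim_mul_linking (Y : C) [Simple Y] :
    ∑ l, dim k (X.obj l) * linking k Y (X.obj l) =
      if IsTransparent Y then globalDim k X * dim k Y else 0 := by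
  split_ifs with h
  · rw [globalDim, Finset.sum_mul]
    refine Finset.sum_congr rfl fun l _ => ?_
    have : doubleBraiding Y (X.obj l) = 𝟙 _ := h _
    rw [linking, this, ← dim, dim_tensor]
    ring
  · by_contra h0
    exact h (isTransparent_of_sum_ne_zero k X Y h0)

end HandleSlide

/-! ### Symmetries of the fusion coefficients -/

section Fusion

variable (k : Type w) [Field k] [IsAlgClosed k] {C : Type u} [Category.{v} C] [Abelian C]
  [Linear k C] [MonoidalCategory C] [IsFusion k C]
  [BraidedCategory C] [RightRigidCategory C]
  [MonoidalPreadditive C] [MonoidalLinear k C]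

/-- `tensorRightHomEquiv` as a linear equivalence. -/
def tensorRightHomLinearEquiv (A B B' Z : C) [ExactPairing B B'] :
    (A ⊗ B ⟶ Z) ≃ₗ[k] (A ⟶ Z ⊗ B') :=
  { tensorRightHomEquiv A B B' Z with
    map_add' := fun f g => by simp [tensorRightHomEquiv]
    map_smul' := fun c f => by simp [tensorRightHomEquiv] }

variable {ι : Type*} [Fintype ι] (X : SimpleReps C ι)

/-- The index of the dual of a simple object. -/
def dualIndex (i : ι) : ι := Classical.choose (exists_iso_rightDual X k (X.obj i))

/-- The representative of the class of the dual is isomorphic to the dual. -/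
def dualIndexIso (i : ι) : X.obj (dualIndex k X i) ≅ ((X.obj i)ᘁ : C) :=
  (Classical.choose_spec (exists_iso_rightDual X k (X.obj i))).some

theorem simple_rightDual_obj (k : Type w) [Field k] [IsAlgClosed k] [Linear k C] [IsFusion k C]
    [MonoidalLinear k C] (i : ι) : Simple ((X.obj i)ᘁ : C) :=
  Simple.of_iso (dualIndexIso k X i).symm

/-- The braiding makes X_i a right dual of X_{i*}, and duals are unique. -/
theorem dualIndex_involutive : Function.Involutive (dualIndex k X) := by
  intro i
  let p : ExactPairing ((X.obj i)ᘁ : C) (X.obj i) := exactPairing_swap (X.obj i) ((X.obj i)ᘁ)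
  let q : ExactPairing (X.obj (dualIndex k X i)) (X.obj i) :=
    exactPairingCongrLeft (dualIndexIso k X i)
  exact X.eq_of_iso _ _ ⟨dualIndexIso k X _ ≪≫ rightDualIso inferInstance q⟩

theorem fusionCoeff_comm (i j l : ι) : fusionCoeff k X i j l = fusionCoeff k X j i l :=
  LinearEquiv.finrank_eq (Linear.homCongr k (Iso.refl _) (β_ _ _))

theorem fusionCoeff_rotate (j l m : ι) :
    fusionCoeff k X j l m = fusionCoeff k X m (dualIndex k X l) j := by
  let p : ExactPairing ((X.obj l)ᘁ : C) (X.obj l) := exactPairing_swap (X.obj l) ((X.obj l)ᘁ)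
  rw [fusionCoeff, fusionCoeff,
    ← LinearEquiv.finrank_eq
      (tensorRightHomLinearEquiv k (X.obj m) ((X.obj l)ᘁ) (X.obj l) (X.obj j)),
    finrank_hom_comm]
  exact LinearEquiv.finrank_eq
    (Linear.homCongr k (Iso.refl _) (whiskerLeftIso (X.obj m) (dualIndexIso k X l).symm))

/-- Three rotations, interleaved with commutativity, dualize all three indices. -/
theorem fusionCoeff_dualIndex (i j l : ι) :
    fusionCoeff k X (dualIndex k X i) (dualIndex k X j) (dualIndex k X l) =
      fusionCoeff k X i j l := by
  rw [fusionCoeff_rotate k X i j l, fusionCoeff_comm k X l, fusionCoeff_rotate k X _ l i,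
    fusionCoeff_comm k X i, fusionCoeff_rotate k X _ i _, fusionCoeff_comm]

end Fusion

/-! ### The identities for s in the Verlinde algebra -/

section Verlinde

variable (k : Type w) [Field k] [IsAlgClosed k] {C : Type u} [Category.{v} C] [Abelian C]
  [Linear k C] [MonoidalCategory C] [IsFusion k C]
  [BraidedCategory C] [RightRigidCategory C] [RibbonCategory C]
  [MonoidalPreadditive C] [MonoidalLinear k C]
  {ι : Type*} [Fintype ι] (X : SimpleReps C ι)

theorem dim_dualIndex (i : ι) : dim k (X.obj (dualIndex k X i)) = dim k (X.obj i) := by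
  rw [dim_eq_of_iso k (dualIndexIso k X i), dim_rightDual]

theorem twistScalar_dualIndex (i : ι) :
    twistScalar k (X.obj (dualIndex k X i)) = twistScalar k (X.obj i) := by
  have := simple_rightDual_obj X k i
  rw [twistScalar_eq_of_iso k (dualIndexIso k X i), twistScalar_rightDual]

theorem sMatrix_eq_linking (i j : ι) :
    sMatrix k X i j = linking k (X.obj (dualIndex k X i)) (X.obj j) :=
  linking_eq_of_iso k (dualIndexIso k X i).symm (Iso.refl _)

theorem linking_dualIndex (i j : ι) :
    linking k (X.obj (dualIndex k X i)) (X.obj (dualIndex k X j)) =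
      linking k (X.obj i) (X.obj j) := by
  have h := linking_mul_twistScalar k X (X.obj i) (X.obj j)
  have h' := linking_mul_twistScalar k X (X.obj (dualIndex k X i)) (X.obj (dualIndex k X j))
  rw [twistScalar_dualIndex, twistScalar_dualIndex] at h'
  refine mul_right_cancel₀ (mul_ne_zero (twistScalar_ne_zero k (X.obj i))
    (twistScalar_ne_zero k (X.obj j))) ?_
  rw [h, h', ← Equiv.sum_comp (dualIndex_involutive k X).toPerm]
  refine Finset.sum_congr rfl fun m _ => ?_
  change (fusionCoeff k X (dualIndex k X i) (dualIndex k X j) (dualIndex k X m) : k) *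
    (twistScalar k (X.obj (dualIndex k X m)) * dim k (X.obj (dualIndex k X m))) = _
  rw [fusionCoeff_dualIndex, twistScalar_dualIndex, dim_dualIndex, fusionCoeff]

theorem linking_mul_linking_obj (Y : C) [Simple Y] (j l : ι) :
    linking k Y (X.obj j) * linking k Y (X.obj l) =
      dim k Y * ∑ m, (fusionCoeff k X j l m : k) * linking k Y (X.obj m) := by
  rw [linking_mul_linking, linking_eq_sum k X]
  rfl

-- The characters of the X_l expand the product over X_a ⊗ X_b*; after exchanging sums, the killing
-- property leaves only transparent c, and N_{ab*}^c = N_{cb}^a.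
open Classical in
theorem sum_linking_mul_linking (a b : ι) :
    ∑ l, linking k (X.obj (dualIndex k X b)) (X.obj l) * linking k (X.obj a) (X.obj l) =
      globalDim k X * ∑ c with IsTransparent (X.obj c),
        dim k (X.obj c) * (fusionCoeff k X c b a : k) := by
  calc
    _ = ∑ l, dim k (X.obj l) * ∑ c, (fusionCoeff k X a (dualIndex k X b) c : k) *
          linking k (X.obj l) (X.obj c) := by
      refine Finset.sum_congr rfl fun l _ => ?_
      rw [← linking_mul_linking_obj, linking_comm k _ (X.obj l), linking_comm k _ (X.obj l),
        mul_comm]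
    _ = ∑ c, (fusionCoeff k X c b a : k) *
          ∑ l, dim k (X.obj l) * linking k (X.obj c) (X.obj l) := by
      simp only [Finset.mul_sum]
      rw [Finset.sum_comm]
      refine Finset.sum_congr rfl fun c _ => Finset.sum_congr rfl fun l _ => ?_
      rw [fusionCoeff_rotate k X c b a, linking_comm k (X.obj l)]
      ring
    _ = _ := by
      rw [Finset.sum_filter, Finset.mul_sum]
      refine Finset.sum_congr rfl fun c _ => ?_
      rw [sum_dim_mul_linking]
      split_ifs
      · ring
      · simp

open Classical in
theorem sum_sMatrix_mul_sMatrix (a b m : ι) :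
    ∑ j, ∑ l, sMatrix k X a j * sMatrix k X b l * (fusionCoeff k X j l m : k) =
      (globalDim k X * ∑ c with IsTransparent (X.obj c),
        dim k (X.obj c) * (fusionCoeff k X c b a : k)) / dim k (X.obj a) * sMatrix k X a m := by
  have hd := dim_ne_zero k X (X.obj a)
  rw [← sum_linking_mul_linking, Finset.sum_comm, Finset.sum_div, Finset.sum_mul]
  refine Finset.sum_congr rfl fun l _ => ?_
  have h := linking_mul_linking_obj k X (X.obj (dualIndex k X a)) m (dualIndex k X l)
  rw [linking_dualIndex, dim_dualIndex] at h
  simp only [sMatrix_eq_linking, fusionCoeff_rotate k X _ l m]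
  rw [div_mul_eq_mul_div, eq_div_iff hd, mul_assoc _ (linking k (X.obj a) (X.obj l)),
    mul_comm (linking k (X.obj a) (X.obj l)), h]
  simp only [Finset.mul_sum, Finset.sum_mul]
  exact Finset.sum_congr rfl fun j _ => by ring

theorem basisVec_eq (i : ι) (c : k) : (Finsupp.single i c : Verlinde k ι) = c • basisVec k i := by
  simp [basisVec]

theorem fusion_basisVec (i j : ι) :
    fusion k X (basisVec k i) (basisVec k j) = ∑ l, (fusionCoeff k X i j l : k) • basisVec k l := by
  simp [fusion, basisVec]

open Classical in
theorem conv_basisVec (i j : ι) :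
    conv k X (basisVec k i) (basisVec k j) =
      ((if i = j then 1 else 0) / dim k (X.obj i)) • basisVec k i := by
  simp [conv, basisVec]

theorem sMap_basisVec (i : ι) : sMap k X (basisVec k i) = ∑ j, sMatrix k X i j • basisVec k j := by
  simp [sMap, basisVec]

theorem basisVec_ext {M : Type*} [AddCommMonoid M] [Module k M] {f g : Verlinde k ι →ₗ[k] M}
    (h : ∀ i, f (basisVec k i) = g (basisVec k i)) : f = g :=
  Finsupp.lhom_ext fun i c => by rw [basisVec_eq, map_smul, map_smul, h]

theorem fusion_comm (x y : Verlinde k ι) : fusion k X x y = fusion k X y x := by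
  have : fusion k X = (fusion k X).flip := by
    refine basisVec_ext k fun i => basisVec_ext k fun j => ?_
    simp only [LinearMap.flip_apply, fusion_basisVec, fusionCoeff_comm k X i j]
  exact congrArg (fun f => f x y) this

theorem conv_comm (x y : Verlinde k ι) : conv k X x y = conv k X y x := by
  classical
  have : conv k X = (conv k X).flip := by
    refine basisVec_ext k fun i => basisVec_ext k fun j => ?_
    simp only [LinearMap.flip_apply, conv_basisVec]
    by_cases h : i = j
    · subst h; rfl
    · simp [h, Ne.symm h]
  exact congrArg (fun f => f x y) this

theorem sMap_conv_fusion_phiJ (x y : Verlinde k ι) :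
    sMap k X (conv k X x (fusion k X (globalDim k X • phiJ k X) y)) =
      fusion k X (sMap k X x) (sMap k X y) := by
  classical
  have : ((conv k X).compl₂ (fusion k X (globalDim k X • phiJ k X))).compr₂ (sMap k X) =
      (fusion k X).compl₁₂ (sMap k X) (sMap k X) := by
    refine basisVec_ext k fun a => basisVec_ext k fun b => ?_
    rw [LinearMap.compr₂_apply, LinearMap.compl₂_apply, LinearMap.compl₁₂_apply]
    -- Convolution with x_a extracts the coefficient of x_a and divides it by d_a.
    have h1 : conv k X (basisVec k a) (fusion k X (globalDim k X • phiJ k X) (basisVec k b)) =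
        ((globalDim k X * ∑ c with IsTransparent (X.obj c),
          dim k (X.obj c) * (fusionCoeff k X c b a : k)) / dim k (X.obj a)) • basisVec k a := by
      simp only [phiJ, map_smul, map_sum, LinearMap.smul_apply, LinearMap.sum_apply,
        fusion_basisVec, conv_basisVec]
      rw [mul_div_assoc, mul_smul, Finset.sum_div, Finset.sum_smul]
      congr 1
      refine Finset.sum_congr rfl fun c _ => ?_
      rw [Finset.sum_eq_single a]
      · simp [smul_smul, div_eq_mul_inv, mul_assoc]
      · intro l _ hl
        simp [hl.symm]
      · simp
    rw [h1, map_smul, sMap_basisVec, sMap_basisVec, Finset.smul_sum]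
    simp only [map_sum, LinearMap.sum_apply, map_smul, LinearMap.smul_apply, fusion_basisVec,
      smul_smul, Finset.smul_sum, ← sum_sMatrix_mul_sMatrix, Finset.sum_smul]
    rw [Finset.sum_comm, Finset.sum_comm (s := Finset.univ (α := ι)) (t := Finset.univ (α := ι))
      (f := fun l j => ∑ m, (sMatrix k X b l * (sMatrix k X a j * (fusionCoeff k X j l m : k))) •
        basisVec k m)]
    refine Finset.sum_congr rfl fun j _ => ?_
    rw [Finset.sum_comm]
    refine Finset.sum_congr rfl fun l _ => Finset.sum_congr rfl fun m _ => ?_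
    rw [mul_left_comm, mul_assoc]
  exact congrArg (fun f => f x y) this

/-- The identities for `s`. -/
theorem sMap_conv_fusion (x y : Verlinde k ι) :
    sMap k X (conv k X (fusion k X (globalDim k X • phiJ k X) x) y) =
        sMap k X (conv k X x (fusion k X (globalDim k X • phiJ k X) y)) ∧
      sMap k X (conv k X x (fusion k X (globalDim k X • phiJ k X) y)) =
        fusion k X (sMap k X x) (sMap k X y) := by
  refine ⟨?_, sMap_conv_fusion_phiJ k X x y⟩
  rw [conv_comm, sMap_conv_fusion_phiJ, sMap_conv_fusion_phiJ, fusion_comm]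

end Verlinde

/-! ### Reversed braiding and the passage from s to s̄ -/

section Reverse

variable (k : Type w) [Field k] [IsAlgClosed k] {C : Type u} [Category.{v} C] [Abelian C]
  [Linear k C] [MonoidalCategory C] [IsFusion k C]
  [BraidedCategory C] [RightRigidCategory C] [RibbonCategory C]
  {ι : Type*} [Fintype ι] (X : SimpleReps C ι)

theorem trace_reverse {Y : C} (f : Y ⟶ Y) :
    @trace k _ _ C _ _ _ _ _ (reverseBraiding C) _ reverseRibbon Y f = trace k f := by
  apply unit_smul_id_injective k (C := C)
  have h := @trace_smul_id k _ _ C _ _ _ _ _ (reverseBraiding C) _ reverseRibbon Y f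
  have hc : @unitTrace C _ _ (reverseBraiding C) _ reverseRibbon Y (Yᘁ) _ f = unitTrace Y (Yᘁ) f :=
    congrArg (fun c => η_ Y (Yᘁ) ≫ f ▷ (Yᘁ) ≫ c) (cap_reverse Y)
  exact (h.trans hc).trans (trace_smul_id k f).symm

theorem dim_reverse (Y : C) :
    @dim k _ _ C _ _ _ _ _ (reverseBraiding C) _ reverseRibbon Y = dim k Y := trace_reverse k _

theorem globalDim_reverse :
    @globalDim k _ _ C _ _ _ _ _ (reverseBraiding C) _ reverseRibbon ι _ X = globalDim k X := by
  simp only [globalDim, dim_reverse]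

theorem isTransparent_reverse (Y : C) :
    @IsTransparent C _ _ (reverseBraiding C) Y ↔ IsTransparent Y := by
  refine forall_congr' fun Z => ?_
  change (β_ Z Y).inv ≫ (β_ Y Z).inv = _ ↔ _
  rw [Iso.inv_comp_eq, Category.comp_id, eq_comm, Iso.hom_comp_eq_id]

theorem phiJ_reverse :
    @phiJ k _ _ C _ _ _ _ _ (reverseBraiding C) _ reverseRibbon ι _ X = phiJ k X := by
  classical
  simp only [phiJ, dim_reverse, isTransparent_reverse]

theorem conv_reverse :
    @conv k _ _ C _ _ _ _ _ (reverseBraiding C) _ reverseRibbon ι X = conv k X := by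
  simp only [conv, dim_reverse]

theorem sMap_reverse :
    @sMap k _ _ C _ _ _ _ _ (reverseBraiding C) _ reverseRibbon ι _ X = sBarMap k X := by
  -- The reversed double braiding is by definition the composite of inverse braidings in s̄_{ij}, so
  -- only the trace has to be compared.
  have h : ∀ i j, @sMatrix k _ _ C _ _ _ _ _ (reverseBraiding C) _ reverseRibbon ι X i j =
      sBarMatrix k X i j := fun i j => trace_reverse k _
  simp only [sMap, sBarMap, h]

end Reverse

end Premodular

end

theorem theoremt {k : Type w} [Field k] [IsAlgClosed k]
    {C : Type u} [Category.{v} C] [Abelian C] [Linear k C]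
    [MonoidalCategory C] [MonoidalPreadditive C] [MonoidalLinear k C]
    [BraidedCategory C] [RightRigidCategory C] [Premodular.RibbonCategory C]
    [Premodular.IsFusion k C]
    {ι : Type*} [Fintype ι] (X : Premodular.SimpleReps C ι)
    (x y : Premodular.Verlinde k ι) :
    (Premodular.sMap k X (Premodular.conv k X
          (Premodular.fusion k X (Premodular.globalDim k X • Premodular.phiJ k X) x) y) =
        Premodular.sMap k X (Premodular.conv k X x
          (Premodular.fusion k X (Premodular.globalDim k X • Premodular.phiJ k X) y)) ∧
      Premodular.sMap k X (Premodular.conv k X x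
          (Premodular.fusion k X (Premodular.globalDim k X • Premodular.phiJ k X) y)) =
        Premodular.fusion k X (Premodular.sMap k X x) (Premodular.sMap k X y)) ∧
    (Premodular.sBarMap k X (Premodular.conv k X
          (Premodular.fusion k X (Premodular.globalDim k X • Premodular.phiJ k X) x) y) =
        Premodular.sBarMap k X (Premodular.conv k X x
          (Premodular.fusion k X (Premodular.globalDim k X • Premodular.phiJ k X) y)) ∧
      Premodular.sBarMap k X (Premodular.conv k X x
          (Premodular.fusion k X (Premodular.globalDim k X • Premodular.phiJ k X) y)) =
        Premodular.fusion k X (Premodular.sBarMap k X x) (Premodular.sBarMap k X y)) := by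
  refine ⟨Premodular.sMap_conv_fusion k X x y, ?_⟩
  have h := @Premodular.sMap_conv_fusion k _ _ C _ _ _ _ _ (reverseBraiding C) _
    Premodular.reverseRibbon _ _ _ _ X x y
  simpa only [Premodular.sMap_reverse, Premodular.conv_reverse, Premodular.phiJ_reverse,
    Premodular.globalDim_reverse] using h
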